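/- Let $n\ge 2$ and $c>0$. For $r\ge 0$ let $C_c^\infty(\mathbb{R}^{1+n};S^r)$ denote the space of smooth, compactly supported, complex-valued symmetric $r$-tensor fields $f$ on $\mathbb{R}^{1+n}$, with components $f_{i_1\dots i_r}$, $0\le i_1,\dots,i_r\le n$, in the standard basis (for $r=0$, scalar functions). For $f\in C_c^\infty(\mathbb{R}^{1+n};S^m)$, an integer $k\ge 0$, $(t,x)\in\mathbb{R}\times\mathbb{R}^n$ and $\omega\in\mathbb{S}^{n-1}$ put $$\tilde L^{m,k}f((t,x),\omega)=\sum_{i_1,\dots,i_m=0}^n \tilde\omega_{i_1}\cdots\tilde\omega_{i_m}\int_{\mathbb{R}} s^k f_{i_1\dots i_m}((t,x)+s\tilde\omega)\,ds,\qquad \tilde\omega=(c,\omega).$$ Let $g_{1/c}=\operatorname{diag}(-1/c^2,1,\dots,1)$, and for $m\ge2$ and a symmetric $(m-2)$-tensor $u$ let $i_{g_{1/c}}u$ be the symmetric product of $u$ with $g_{1/c}$, that is, $$(i_{g_{1/c}}u)_{i_1\dots i_m}=\frac1{m!}\sum_{\pi} u_{i_{\pi(1)}\dots i_{\pi(m-2)}}\,(g_{1/c})_{i_{\pi(m-1)}i_{\pi(m)}},$$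 where $\pi$ runs over all permutations of $\{1,\dots,m\}$. Let $m\ge 0$ and $f\in C_c^\infty(\mathbb{R}^{1+n};S^m)$, and suppose that $\tilde L^{m,m}f((t,x),\omega)=0$ for all $(t,x)\in\mathbb{R}^{1+n}$ and all $\omega\in\mathbb{S}^{n-1}$. If $m=0$ or $m=1$, then $f=0$. If $m\ge 2$, then $f=i_{g_{1/c}}h$ for some $h\in C_c^\infty(\mathbb{R}^{1+n};S^{m-2})$. Conversely, if $m\ge2$ and $h\in C_c^\infty(\mathbb{R}^{1+n};S^{m-2})$, then $i_{g_{1/c}}h\in C_c^\infty(\mathbb{R}^{1+n};S^m)$ and $\tilde L^{m,k}(i_{g_{1/c}}h)=0$ on $\mathbb{R}^{1+n}\times\mathbb{S}^{n-1}$ for every $k\ge 0$; in particular this holds for $k=m$. -/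

import Mathlib

noncomputable section

namespace LightRay

/-- The space-time `ℝ^{1+n}`, whose points are `(x_0, x_1, …, x_n)` with `x_0 = t`. -/
abbrev Spacetime (n : ℕ) : Type := EuclideanSpace ℝ (Fin (n + 1))

/-- The complex vector space of symmetric `m`-tensors on `ℝ^{1+n}`. A tensor is given by its
components `u i = u_{i_1 … i_m}` in the standard basis `e_0, …, e_n`, where
`i = (i_1, …, i_m)`. -/
def SymTensor (n m : ℕ) : Submodule ℂ ((Fin m → Fin (n + 1)) → ℂ) where
  carrier := {u | ∀ (π : Equiv.Perm (Fin m)) (i : Fin m → Fin (n + 1)), u (i ∘ π) = u i}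
  zero_mem' := fun _ _ => rfl
  add_mem' := fun {u v} hu hv π i => by
    simp only [Pi.add_apply, hu π i, hv π i]
  smul_mem' := fun a u hu π i => by
    simp only [Pi.smul_apply, hu π i]

/-- `C_c^∞(ℝ^{1+n}; S^m)`: the smooth compactly supported symmetric `m`-tensor fields. -/
def CcField (n m : ℕ) : Set (Spacetime n → SymTensor n m) :=
  {f | ContDiff ℝ (⊤ : ℕ∞) f ∧ HasCompactSupport f}

/-- The direction `(c, ω)` in `ℝ^{1+n}`. -/
def lightDir {n : ℕ} (c : ℝ) (ω : EuclideanSpace ℝ (Fin n)) : Spacetime n :=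
  WithLp.toLp 2 (Fin.cons c (fun j : Fin n => ω j))

/-- The `k`-th momentum light ray transform `L^{m,k} f ((t,x), ω)` of an `m`-tensor field, at the
point `p = (t,x)`:
`∑_{i_1,…,i_m} ω̃_{i_1} ⋯ ω̃_{i_m} ∫ s^k f_{i_1…i_m}(p + s ω̃) ds`, with `ω̃ = (c, ω)`. -/
def mlrt {n m : ℕ} (c : ℝ) (k : ℕ) (f : Spacetime n → SymTensor n m)
    (p : Spacetime n) (ω : EuclideanSpace ℝ (Fin n)) : ℂ :=
  ∑ i : Fin m → Fin (n + 1),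
    (∏ j : Fin m, ((lightDir c ω (i j) : ℝ) : ℂ)) *
      ∫ s : ℝ, (s : ℂ) ^ k * (f (p + s • lightDir c ω) : (Fin m → Fin (n + 1)) → ℂ) i

/-- The restriction of the momentum light ray transform to directions `ω` in the unit sphere
`S^{n-1}` of `ℝ^n`. -/
def sphereMlrt {n m : ℕ} (c : ℝ) (k : ℕ) (f : Spacetime n → SymTensor n m)
    (p : Spacetime n) (ω : Metric.sphere (0 : EuclideanSpace ℝ (Fin n)) 1) : ℂ :=
  mlrt c k f p (ω : EuclideanSpace ℝ (Fin n))

/-- The Minkowski metric `g_c = diag(-c², 1, …, 1)`, as a symmetric `2`-tensor. -/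
def minkowski (n : ℕ) (c : ℝ) : SymTensor n 2 :=
  ⟨fun i => if i 0 = i 1 then (if i 0 = 0 then -((c : ℂ) ^ 2) else 1) else 0, by
    intro π i
    have hπ : (π 0 = 0 ∧ π 1 = 1) ∨ (π 0 = 1 ∧ π 1 = 0) := by
      have h : π 0 ≠ π 1 := fun h => by simpa using π.injective h
      omega
    rcases hπ with ⟨h0, h1⟩ | ⟨h0, h1⟩
    · simp only [Function.comp_apply, h0, h1]
    · simp only [Function.comp_apply, h0, h1]
      by_cases h : i 0 = i 1
      · simp only [h]
      · simp only [h, Ne.symm h, if_false]⟩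

/-- The operator `i_v : S^m → S^{m+2}`, `u ↦ v ⊙ u`, for a symmetric `2`-tensor `v`:
`(i_v u)_{i_1…i_{m+2}}` is the average over the permutations `π` of `{1, …, m+2}` of
`u_{i_{π(1)}…i_{π(m)}} v_{i_{π(m+1)} i_{π(m+2)}}`. -/
def symMul {n m : ℕ} (v : SymTensor n 2) (u : SymTensor n m) : SymTensor n (m + 2) :=
  ⟨fun i => (1 / ((m + 2).factorial : ℂ)) * ∑ π : Equiv.Perm (Fin (m + 2)),
      (u : (Fin m → Fin (n + 1)) → ℂ) (fun j => i (π (Fin.castAdd 2 j))) *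
        (v : (Fin 2 → Fin (n + 1)) → ℂ) (fun j => i (π (Fin.natAdd m j))), by
    intro ρ i
    refine congrArg (fun z : ℂ => (1 / ((m + 2).factorial : ℂ)) * z) ?_
    exact Fintype.sum_equiv (Equiv.mulLeft ρ) _ _ (fun π => rfl)⟩

end LightRay

end

open MeasureTheory Filter Topology FourierTransform

/-! Write `g ω q` for the contraction of `f q` with the light direction `ω̃ = (c, ω)`. Sliding the
base point along its line makes the vanishing integral a polynomial in the shift, so all moments of
`g ω` of order at most `m` vanish along lines of direction `ω̃` (`moments_eq_zero`). Taylor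
expansion of the exponential along these lines bounds the Fourier transform of `g ω` at `ξ` by `K
|⟨ω̃, ξ⟩| ^ (m + 1)`, with `K` independent of `ω` (`exists_norm_fourier_le`).

This transform is the contraction of the transform of `f` at `ξ` with `ω̃`, a form of degree only
`m`. If `c |ξ_0|` is less than the norm of the spatial part of `ξ`, two distinct light directions
are orthogonal to `ξ`. On a conic in the light cone through them and any third light direction, the
order of vanishing is too high for the degree, so the form is zero there
(`contract_lightDir_eq_zero_of_le`). Such `ξ` form a nonempty open set, and the transform of `g ω`
is analytic, so `g ω = 0` (`eq_zero_of_fourier_eq_zero_on`).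

Thus `f q`, read as a homogeneous polynomial, vanishes on the real light cone and is divisible by
the quadratic form of `g_{1/c}` (`minkowski_dvd`). In degree below two this forces zero; otherwise
the quotient gives `h q`, and choosing it linearly in `f q` preserves smoothness and compact
support. The converse holds because the metric vanishes on light directions. -/

namespace LightRay

/-! ### Symmetric tensors as homogeneous polynomials -/

/-- The contraction `∑ T_{i_1 … i_m} x_{i_1} ⋯ x_{i_m}` of a tensor with the `m`-th power of a
vector with entries in a commutative `ℂ`-algebra. -/
def contract {ι R : Type*} [Fintype ι] [CommRing R] [Algebra ℂ R] {m : ℕ}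
    (T : (Fin m → ι) → ℂ) (x : ι → R) : R :=
  ∑ i : Fin m → ι, algebraMap ℂ R (T i) * ∏ j, x (i j)

section contract

variable {ι R S : Type*} [Fintype ι] [CommRing R] [Algebra ℂ R] [CommRing S] [Algebra ℂ S] {m : ℕ}

lemma map_contract (φ : R →ₐ[ℂ] S) (T : (Fin m → ι) → ℂ) (x : ι → R) :
    φ (contract T x) = contract T (fun i => φ (x i)) := by
  simp [contract, map_sum, map_prod]

lemma contract_smul (T : (Fin m → ι) → ℂ) (a : R) (x : ι → R) :
    contract T (fun i => a * x i) = a ^ m * contract T x := by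
  simp only [contract, Finset.mul_sum, Finset.prod_mul_distrib, Finset.prod_const,
    Finset.card_univ, Fintype.card_fin]
  exact Finset.sum_congr rfl fun i _ => by ring

lemma contract_sub (T T' : (Fin m → ι) → ℂ) (x : ι → R) :
    contract (T - T') x = contract T x - contract T' x := by
  simp [contract, ← Finset.sum_sub_distrib, sub_mul]

lemma contract_comp_perm (π : Equiv.Perm (Fin m)) (T : (Fin m → ι) → ℂ) (x : ι → R) :
    contract (fun i => T (i ∘ π)) x = contract T x := by
  unfold contract
  refine Fintype.sum_equiv (Equiv.arrowCongr π.symm (Equiv.refl ι)) _ _ fun i => ?_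
  congr 1
  exact (Equiv.prod_comp π fun j => x (i j)).symm

lemma contract_append {k : ℕ} (u : (Fin m → ι) → ℂ) (v : (Fin k → ι) → ℂ) (x : ι → R) :
    contract (fun i : Fin (m + k) → ι =>
      u (fun j => i (Fin.castAdd k j)) * v (fun j => i (Fin.natAdd m j))) x =
      contract u x * contract v x := by
  unfold contract
  rw [Finset.sum_mul_sum, ← Fintype.sum_prod_type']
  refine Fintype.sum_equiv (Fin.appendEquiv m k).symm _ _ fun i => ?_
  simp only [map_mul, Fin.prod_univ_add, Fin.appendEquiv]
  simp
  ring

end contract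

/-- Contraction does not see the order of the indices, so the `(m + 2)!` terms of the symmetrization
are equal and their average is the plain product. -/
lemma contract_symMul {n m : ℕ} {R : Type*} [CommRing R] [Algebra ℂ R] (v : SymTensor n 2)
    (u : SymTensor n m) (x : Fin (n + 1) → R) :
    contract (symMul v u : (Fin (m + 2) → Fin (n + 1)) → ℂ) x =
      contract (u : (Fin m → Fin (n + 1)) → ℂ) x * contract (v : (Fin 2 → Fin (n + 1)) → ℂ) x := by
  have h : ∀ π : Equiv.Perm (Fin (m + 2)),
      contract (fun i : Fin (m + 2) → Fin (n + 1) =>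
        (u : (Fin m → Fin (n + 1)) → ℂ) (fun j => i (π (Fin.castAdd 2 j))) *
        (v : (Fin 2 → Fin (n + 1)) → ℂ) (fun j => i (π (Fin.natAdd m j)))) x =
      contract (u : (Fin m → Fin (n + 1)) → ℂ) x *
        contract (v : (Fin 2 → Fin (n + 1)) → ℂ) x := fun π => by
    rw [← contract_append]
    exact contract_comp_perm π (fun i => (u : (Fin m → Fin (n + 1)) → ℂ)
      (fun j => i (Fin.castAdd 2 j)) * (v : (Fin 2 → Fin (n + 1)) → ℂ)
        (fun j => i (Fin.natAdd m j))) x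
  have key : contract (symMul v u : (Fin (m + 2) → Fin (n + 1)) → ℂ) x =
      algebraMap ℂ R (1 / ((m + 2).factorial : ℂ)) * ∑ π : Equiv.Perm (Fin (m + 2)),
      contract (fun i : Fin (m + 2) → Fin (n + 1) =>
        (u : (Fin m → Fin (n + 1)) → ℂ) (fun j => i (π (Fin.castAdd 2 j))) *
        (v : (Fin 2 → Fin (n + 1)) → ℂ) (fun j => i (π (Fin.natAdd m j)))) x := by
    simp only [contract]
    rw [Finset.sum_comm, Finset.mul_sum]
    refine Finset.sum_congr rfl fun i _ => ?_
    rw [symMul, ← Finset.sum_mul, ← map_sum, map_mul, mul_assoc]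
  rw [key, Finset.sum_congr rfl fun π _ => h π, Finset.sum_const, Finset.card_univ,
    Fintype.card_perm, Fintype.card_fin, nsmul_eq_mul, ← mul_assoc,
    ← map_natCast (algebraMap ℂ R), ← map_mul, one_div,
    inv_mul_cancel₀ (Nat.cast_ne_zero.2 (Nat.factorial_ne_zero _)), map_one, one_mul]

lemma contract_minkowski {n : ℕ} {R : Type*} [CommRing R] [Algebra ℂ R] (c : ℝ)
    (x : Fin (n + 1) → R) :
    contract (minkowski n c : (Fin 2 → Fin (n + 1)) → ℂ) x =
      - algebraMap ℂ R ((c : ℂ) ^ 2) * x 0 ^ 2 + ∑ j : Fin n, x j.succ ^ 2 := by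
  unfold contract minkowski
  rw [← (finTwoArrowEquiv (Fin (n + 1))).symm.sum_comp, Fintype.sum_prod_type]
  simp [Fin.prod_univ_two, Fin.sum_univ_succ, Fin.succ_ne_zero, apply_ite,
    ite_mul, pow_two]

section polynomial

variable {ι : Type*} {m : ℕ}

/-- The exponents of the monomial `X_{i_1} ⋯ X_{i_m}`. -/
noncomputable def exponents (i : Fin m → ι) : ι →₀ ℕ := ∑ j, Finsupp.single (i j) 1

lemma exponents_comp_perm (i : Fin m → ι) (π : Equiv.Perm (Fin m)) :
    exponents (i ∘ π) = exponents i :=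
  Equiv.sum_comp π fun j => Finsupp.single (i j) 1

lemma exponents_apply (i : Fin m → ι) (a : ι) :
    exponents i a = Nat.card {j // i j = a} := by
  classical
  simp [exponents, Nat.card_eq_fintype_card, Finsupp.finsetSum_apply, Finsupp.single_apply, Fintype.card_subtype]

/-- Equal exponents mean that the fibres over each index have equal size; bijections between the
fibres glue to a permutation. -/
lemma exists_perm_of_exponents_eq {i i' : Fin m → ι} (h : exponents i = exponents i') :
    ∃ π : Equiv.Perm (Fin m), i = i' ∘ π := by
  let e : ∀ a, {j // i j = a} ≃ {j // i' j = a} := fun a => (Finite.card_eq.1 (by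
    rw [← exponents_apply, ← exponents_apply, h])).some
  refine ⟨(Equiv.sigmaFiberEquiv i).symm.trans
    ((Equiv.sigmaCongrRight e).trans (Equiv.sigmaFiberEquiv i')), ?_⟩
  funext j
  exact ((e (i j) ⟨j, rfl⟩).2).symm

lemma exists_exponents_eq (d : ι →₀ ℕ) : ∃ i : Fin d.degree → ι, exponents i = d := by
  obtain ⟨l, hl⟩ : ∃ l : List ι, (l : Multiset ι) = Finsupp.toMultiset d :=
    Quotient.exists_rep _
  have hlen : l.length = d.degree := by
    rw [← Multiset.coe_card, hl, Finsupp.card_toMultiset, Finsupp.degree]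
    rfl
  rw [← hlen]
  refine ⟨l.get, ?_⟩
  classical
  refine (Finsupp.toMultiset_eq_iff.1 ?_).trans (Finsupp.toMultiset_toFinsupp d)
  rw [← hl, exponents, map_sum]
  simp only [Finsupp.toMultiset_single, one_smul]
  rw [← Multiset.sum_map_singleton (l : Multiset ι), Multiset.map_coe, Multiset.sum_coe]
  exact Fin.sum_univ_fun_getElem l fun a => ({a} : Multiset ι)

lemma coeff_contract_X [Fintype ι] [DecidableEq ι] (T : (Fin m → ι) → ℂ) (d : ι →₀ ℕ) :
    MvPolynomial.coeff d (contract T (MvPolynomial.X : ι → MvPolynomial ι ℂ)) =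
      ∑ i with exponents i = d, T i := by
  have h : ∀ i : Fin m → ι, ∏ j, (MvPolynomial.X (i j) : MvPolynomial ι ℂ) =
      MvPolynomial.monomial (exponents i) 1 := fun i => by
    simp [exponents, MvPolynomial.monomial_sum_one, MvPolynomial.X]
  simp only [contract, h, MvPolynomial.algebraMap_eq, MvPolynomial.coeff_sum,
    MvPolynomial.coeff_C_mul, MvPolynomial.coeff_monomial, mul_ite, mul_one, mul_zero,
    Finset.sum_filter]

lemma isHomogeneous_contract_X [Fintype ι] (T : (Fin m → ι) → ℂ) :
    (contract T (MvPolynomial.X : ι → MvPolynomial ι ℂ)).IsHomogeneous m := by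
  refine MvPolynomial.IsHomogeneous.sum _ _ _ fun i _ => ?_
  rw [MvPolynomial.algebraMap_eq]
  simpa using (MvPolynomial.isHomogeneous_C ι (T i)).mul
    (MvPolynomial.IsHomogeneous.prod Finset.univ (fun j => MvPolynomial.X (i j)) (fun _ => 1)
      fun j _ => MvPolynomial.isHomogeneous_X ℂ (i j))

end polynomial

/-- By symmetry `T` is constant on the tuples with a given monomial, so each coefficient is a
positive integer times a component. -/
lemma eq_zero_of_contract_X_eq_zero {n m : ℕ} (T : SymTensor n m)
    (h : contract (T : (Fin m → Fin (n + 1)) → ℂ)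
      (MvPolynomial.X : Fin (n + 1) → MvPolynomial (Fin (n + 1)) ℂ) = 0) : T = 0 := by
  ext i
  have h1 := coeff_contract_X (T : (Fin m → Fin (n + 1)) → ℂ) (exponents i)
  rw [h, MvPolynomial.coeff_zero, Finset.sum_congr rfl (g := fun _ => T.1 i), Finset.sum_const,
    nsmul_eq_mul, eq_comm, mul_eq_zero, Nat.cast_eq_zero, Finset.card_eq_zero] at h1
  · refine h1.resolve_left fun h2 => ?_
    have : i ∈ Finset.univ.filter fun i' : Fin m → Fin (n + 1) => exponents i' = exponents i := by
      simp
    simp [h2] at this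
  · intro i' hi'
    obtain ⟨π, rfl⟩ := exists_perm_of_exponents_eq (Finset.mem_filter.1 hi').2
    exact T.2 π i

lemma exists_contract_X_eq {n m : ℕ} {p : MvPolynomial (Fin (n + 1)) ℂ} (hp : p.IsHomogeneous m) :
    ∃ T : SymTensor n m, contract (T : (Fin m → Fin (n + 1)) → ℂ) MvPolynomial.X = p := by
  let N : (Fin (n + 1) →₀ ℕ) → ℕ := fun d =>
    (Finset.univ.filter fun i : Fin m → Fin (n + 1) => exponents i = d).card
  -- Each coefficient is shared equally among the `N` tuples that produce its monomial.
  refine ⟨⟨fun i => p.coeff (exponents i) / N (exponents i), fun π i => by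
    simp only [exponents_comp_perm]⟩, ?_⟩
  ext d
  rw [coeff_contract_X, Finset.sum_congr rfl (g := fun _ => p.coeff d / N d), Finset.sum_const,
    nsmul_eq_mul]
  · by_cases hd : d.degree = m
    · subst hd
      obtain ⟨i, hi⟩ := exists_exponents_eq d
      have : N d ≠ 0 := Finset.card_ne_zero_of_mem (a := i) (by simp [hi])
      exact mul_div_cancel₀ _ (Nat.cast_ne_zero.2 this)
    · rw [hp.coeff_eq_zero hd]
      simp
  · intro i hi
    simp only [(Finset.mem_filter.1 hi).2]

/-! ### Forms vanishing on the light cone -/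

/-- A real vector on the light cone is a multiple of a vector `(c, ω)`, up to its time component
being nonzero. -/
lemma exists_eq_mul_lightDir {n : ℕ} {c : ℝ} (hc : 0 < c) {v : Fin (n + 1) → ℝ} (hv0 : v 0 ≠ 0)
    (hv : c ^ 2 * ∑ j : Fin n, v j.succ ^ 2 = v 0 ^ 2) :
    ∃ ω : Metric.sphere (0 : EuclideanSpace ℝ (Fin n)) 1,
      ∀ i, v i = v 0 / c * lightDir c (ω : EuclideanSpace ℝ (Fin n)) i := by
  refine ⟨⟨WithLp.toLp 2 fun j => c / v 0 * v j.succ, ?_⟩, fun i => ?_⟩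
  · rw [mem_sphere_zero_iff_norm, EuclideanSpace.norm_eq, Real.sqrt_eq_one]
    simp only [Real.norm_eq_abs, sq_abs, mul_pow, ← Finset.mul_sum]
    field_simp
    linarith
  · refine Fin.cases ?_ (fun j => ?_) i
    · simp [lightDir, hc.ne']
    · simp [lightDir]
      field_simp

lemma contract_eq_zero_of_null {n m : ℕ} {c : ℝ} (hc : 0 < c) {T : (Fin m → Fin (n + 1)) → ℂ}
    (hT : ∀ ω : Metric.sphere (0 : EuclideanSpace ℝ (Fin n)) 1,
      contract T (fun i => ((lightDir c (ω : EuclideanSpace ℝ (Fin n)) i : ℝ) : ℂ)) = 0)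
    {v : Fin (n + 1) → ℝ} (hv0 : v 0 ≠ 0) (hv : c ^ 2 * ∑ j : Fin n, v j.succ ^ 2 = v 0 ^ 2) :
    contract T (fun i => (v i : ℂ)) = 0 := by
  obtain ⟨ω, hω⟩ := exists_eq_mul_lightDir hc hv0 hv
  have : (fun i => (v i : ℂ)) = fun i => ((v 0 / c : ℝ) : ℂ) *
      ((lightDir c (ω : EuclideanSpace ℝ (Fin n)) i : ℝ) : ℂ) := by
    funext i
    rw [hω i]
    push_cast
    rfl
  rw [this, contract_smul, hT ω, mul_zero]

/-- Division by the quadratic form of the light cone. -/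
lemma minkowski_dvd {n : ℕ} (hn : 0 < n) {c : ℝ} (hc : 0 < c) (p : MvPolynomial (Fin (n + 1)) ℂ)
    (hp : ∀ v : Fin (n + 1) → ℝ, v 0 ≠ 0 → c ^ 2 * ∑ j : Fin n, v j.succ ^ 2 = v 0 ^ 2 →
      MvPolynomial.eval (fun i => (v i : ℂ)) p = 0) :
    contract (minkowski n (1 / c) : (Fin 2 → Fin (n + 1)) → ℂ)
      (MvPolynomial.X : Fin (n + 1) → MvPolynomial (Fin (n + 1)) ℂ) ∣ p := by
  have hc' : (c : ℂ) ≠ 0 := Complex.ofReal_ne_zero.2 hc.ne'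
  let s : MvPolynomial (Fin n) ℂ := ∑ j, MvPolynomial.X j ^ 2
  let D : Polynomial (MvPolynomial (Fin n) ℂ) :=
    Polynomial.X ^ 2 - Polynomial.C (MvPolynomial.C ((c : ℂ) ^ 2) * s)
  have hD : D.Monic := Polynomial.monic_X_pow_sub_C _ two_ne_zero
  have hDdeg : D.degree = 2 := Polynomial.degree_X_pow_sub_C two_pos _
  -- The factor `-c²` makes the form monic in the time variable, so division with remainder applies
  -- over the polynomials in the space variables.
  have hQ : Polynomial.C (MvPolynomial.C (-(c : ℂ) ^ 2)) * MvPolynomial.finSuccEquiv ℂ n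
      (contract (minkowski n (1 / c) : (Fin 2 → Fin (n + 1)) → ℂ) MvPolynomial.X) = D := by
    rw [contract_minkowski, MvPolynomial.algebraMap_eq]
    simp only [map_add, map_mul, map_neg, map_pow, map_sum, MvPolynomial.finSuccEquiv_X_zero,
      MvPolynomial.finSuccEquiv_X_succ, D, s]
    have e1 : MvPolynomial.finSuccEquiv ℂ n (MvPolynomial.C ((1 / c : ℝ) : ℂ)) =
        Polynomial.C (MvPolynomial.C ((1 / c : ℝ) : ℂ)) := by
      simp [MvPolynomial.finSuccEquiv_apply]
    have e2 : (Polynomial.C (MvPolynomial.C (c : ℂ)) : Polynomial (MvPolynomial (Fin n) ℂ)) *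
        Polynomial.C (MvPolynomial.C ((1 / c : ℝ) : ℂ)) = 1 := by
      rw [← map_mul, ← map_mul]
      push_cast
      rw [mul_one_div_cancel hc', map_one, map_one]
    rw [e1]
    linear_combination (Polynomial.C (MvPolynomial.C (c : ℂ)) *
      Polynomial.C (MvPolynomial.C ((1 / c : ℝ) : ℂ)) + 1) * Polynomial.X ^ 2 * e2
  set P := MvPolynomial.finSuccEquiv ℂ n p with hP
  have hdeg : (P %ₘ D).degree < 2 := hDdeg ▸ Polynomial.degree_modByMonic_lt P hD
  obtain ⟨a, b, hab⟩ : ∃ a b, P %ₘ D = Polynomial.C a * Polynomial.X + Polynomial.C b :=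
    ⟨_, _, Polynomial.eq_X_add_C_of_degree_le_one (Order.le_of_lt_succ hdeg)⟩
  have hdiv := Polynomial.modByMonic_add_div P D
  -- Over a point `y` with positive coordinates, `z = ±c|y|` are two distinct real points of the
  -- cone, and a remainder of degree at most one in `z` that vanishes at both is zero.
  have hval : ∀ x : Fin n → ℂ, x ∈ Set.pi Set.univ (fun _ => (fun t : ℝ => (t : ℂ)) '' Set.Ioi 0) →
      MvPolynomial.eval x a = 0 ∧ MvPolynomial.eval x b = 0 := by
    intro x hx
    choose y hy hyx using fun j => hx j (Set.mem_univ j)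
    have hpos : 0 < ∑ j, y j ^ 2 :=
      Finset.sum_pos (fun j _ => pow_pos (hy j) 2) ⟨⟨0, hn⟩, Finset.mem_univ _⟩
    have key : ∀ z : ℝ, z ≠ 0 → z ^ 2 = c ^ 2 * ∑ j, y j ^ 2 →
        MvPolynomial.eval x a * z + MvPolynomial.eval x b = 0 := by
      intro z hz0 hz
      have h1 := hp (Fin.cons z y) (by simpa) (by simp [hz])
      have h2 : (fun i => ((Fin.cons z y : Fin (n + 1) → ℝ) i : ℂ)) =
          Fin.cases (MvPolynomial.eval x (MvPolynomial.C (z : ℂ))) x := by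
        funext i
        refine Fin.cases ?_ (fun j => ?_) i
        · simp
        · simp [← hyx]
      rw [h2, ← MvPolynomial.eval_polynomial_eval_finSuccEquiv, ← hP, ← hdiv, hab] at h1
      have h3 : MvPolynomial.eval x (D.eval (MvPolynomial.C (z : ℂ))) = 0 := by
        simp only [D, Polynomial.eval_sub, Polynomial.eval_pow, Polynomial.eval_X,
          Polynomial.eval_C]
        simp only [s, map_sub, map_pow, map_mul, map_sum, MvPolynomial.eval_C,
          MvPolynomial.eval_X, ← hyx]
        exact_mod_cast sub_eq_zero.2 hz
      simpa [h3] using h1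
    have hr : (c * √(∑ j, y j ^ 2)) ^ 2 = c ^ 2 * ∑ j, y j ^ 2 := by
      rw [mul_pow, Real.sq_sqrt hpos.le]
    have hr0 : c * √(∑ j, y j ^ 2) ≠ 0 := (mul_pos hc (Real.sqrt_pos.2 hpos)).ne'
    have k1 := key _ hr0 hr
    have k2 := key _ (neg_ne_zero.2 hr0) (by rw [neg_sq, hr])
    rw [Complex.ofReal_neg] at k2
    have k3 : MvPolynomial.eval x b = 0 := by linear_combination (k1 + k2) / 2
    rw [k3, add_zero] at k1
    exact ⟨(mul_eq_zero.1 k1).resolve_right (Complex.ofReal_ne_zero.2 hr0), k3⟩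
  have hinf : ∀ _ : Fin n, ((fun t : ℝ => (t : ℂ)) '' Set.Ioi 0).Infinite := fun _ =>
    (Set.Ioi_infinite 0).image Complex.ofReal_injective.injOn
  have ha : a = 0 := MvPolynomial.funext_set _ hinf fun x hx => by simpa using (hval x hx).1
  have hb : b = 0 := MvPolynomial.funext_set _ hinf fun x hx => by simpa using (hval x hx).2
  have hPD : P = D * (P /ₘ D) := by
    rw [hab, ha, hb] at hdiv
    simpa using hdiv.symm
  rw [← map_dvd_iff (MvPolynomial.finSuccEquiv ℂ n), ← hP]
  refine ⟨Polynomial.C (MvPolynomial.C (-(c : ℂ) ^ 2)) * (P /ₘ D), ?_⟩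
  rw [← mul_assoc, mul_comm (MvPolynomial.finSuccEquiv ℂ n _), hQ]
  exact hPD

/-- Multiplication by `Q` shifts degrees by `d`. Hence the quotient of two forms may be taken
homogeneous, and a multiple of `Q` has no component of degree below `d`. -/
lemma homogeneousComponent_mul {σ : Type*} {d : ℕ} {Q : MvPolynomial σ ℂ} (hQ : Q.IsHomogeneous d)
    (q : MvPolynomial σ ℂ) (k : ℕ) :
    MvPolynomial.homogeneousComponent k (Q * q) =
      if d ≤ k then Q * MvPolynomial.homogeneousComponent (k - d) q else 0 := by
  have h : ∀ i, MvPolynomial.homogeneousComponent k (Q * MvPolynomial.homogeneousComponent i q) =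
      if k = d + i then Q * MvPolynomial.homogeneousComponent i q else 0 := fun i =>
    MvPolynomial.homogeneousComponent_of_mem
      (hQ.mul (MvPolynomial.homogeneousComponent_isHomogeneous i q))
  conv_lhs => rw [← MvPolynomial.sum_homogeneousComponent q, Finset.mul_sum, map_sum,
    Finset.sum_congr rfl fun i _ => h i]
  split_ifs with hk
  · rw [Finset.sum_eq_single (k - d)]
    · simp [Nat.add_sub_cancel' hk]
    · intro i _ hi
      rw [if_neg (by omega)]
    · intro hi
      rw [MvPolynomial.homogeneousComponent_eq_zero _ _ (by
        simpa only [Finset.mem_range, not_lt, Nat.succ_le_iff] using hi)]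
      simp
  · exact Finset.sum_eq_zero fun i _ => if_neg (by omega)

/-- Multiplication by a symmetric `2`-tensor, as a linear map. -/
noncomputable def symMulLin {n : ℕ} (m : ℕ) (v : SymTensor n 2) :
    SymTensor n m →ₗ[ℂ] SymTensor n (m + 2) where
  toFun := symMul v
  map_add' u w := by
    ext i
    simp [symMul, add_mul, Finset.sum_add_distrib, mul_add]
  map_smul' a u := by
    ext i
    simp only [symMul, SetLike.val_smul, Pi.smul_apply, smul_eq_mul, Finset.mul_sum,
      RingHom.id_apply]
    exact Finset.sum_congr rfl fun π _ => by ring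

section vanishing

variable {n m : ℕ} {c : ℝ}

lemma minkowski_dvd_contract (hn : 0 < n) (hc : 0 < c) (T : SymTensor n m)
    (hT : ∀ ω : Metric.sphere (0 : EuclideanSpace ℝ (Fin n)) 1,
      contract (T : (Fin m → Fin (n + 1)) → ℂ)
        (fun i => ((lightDir c (ω : EuclideanSpace ℝ (Fin n)) i : ℝ) : ℂ)) = 0) :
    contract (minkowski n (1 / c) : (Fin 2 → Fin (n + 1)) → ℂ)
      (MvPolynomial.X : Fin (n + 1) → MvPolynomial (Fin (n + 1)) ℂ) ∣
      contract (T : (Fin m → Fin (n + 1)) → ℂ) MvPolynomial.X := by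
  refine minkowski_dvd hn hc _ fun v hv0 hv => ?_
  have := map_contract (MvPolynomial.aeval fun i => (v i : ℂ)) (T : (Fin m → Fin (n + 1)) → ℂ)
    MvPolynomial.X
  rw [← MvPolynomial.aeval_eq_eval, this]
  simpa only [MvPolynomial.aeval_X] using contract_eq_zero_of_null hc hT hv0 hv

lemma eq_zero_of_contract_lightDir_eq_zero (hn : 0 < n) (hc : 0 < c) (hm : m < 2)
    (T : SymTensor n m)
    (hT : ∀ ω : Metric.sphere (0 : EuclideanSpace ℝ (Fin n)) 1,
      contract (T : (Fin m → Fin (n + 1)) → ℂ)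
        (fun i => ((lightDir c (ω : EuclideanSpace ℝ (Fin n)) i : ℝ) : ℂ)) = 0) : T = 0 := by
  obtain ⟨q, hq⟩ := minkowski_dvd_contract hn hc T hT
  refine eq_zero_of_contract_X_eq_zero T ?_
  rw [← MvPolynomial.homogeneousComponent_eq_self (isHomogeneous_contract_X _), hq,
    homogeneousComponent_mul (isHomogeneous_contract_X _), if_neg (by omega)]

/-- Only the degree `m` component of the quotient contributes, and that component is the polynomial
of a symmetric tensor. -/
lemma mem_range_symMulLin (hn : 0 < n) (hc : 0 < c) (T : SymTensor n (m + 2))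
    (hT : ∀ ω : Metric.sphere (0 : EuclideanSpace ℝ (Fin n)) 1,
      contract (T : (Fin (m + 2) → Fin (n + 1)) → ℂ)
        (fun i => ((lightDir c (ω : EuclideanSpace ℝ (Fin n)) i : ℝ) : ℂ)) = 0) :
    T ∈ LinearMap.range (symMulLin m (minkowski n (1 / c))) := by
  obtain ⟨q, hq⟩ := minkowski_dvd_contract hn hc T hT
  obtain ⟨h, hh⟩ := exists_contract_X_eq
    (MvPolynomial.homogeneousComponent_isHomogeneous m q)
  have hT' := MvPolynomial.homogeneousComponent_eq_self (isHomogeneous_contract_X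
    (T : (Fin (m + 2) → Fin (n + 1)) → ℂ))
  rw [hq, homogeneousComponent_mul (isHomogeneous_contract_X _), if_pos (by omega),
    Nat.add_sub_cancel, ← hh, ← hq] at hT'
  refine ⟨h, sub_eq_zero.1 (eq_zero_of_contract_X_eq_zero _ ?_)⟩
  refine (contract_sub (symMul (minkowski n (1 / c)) h).1 T.1 MvPolynomial.X).trans ?_
  rw [contract_symMul, mul_comm, hT', sub_self]

lemma contract_minkowski_lightDir (hc : 0 < c)
    (ω : Metric.sphere (0 : EuclideanSpace ℝ (Fin n)) 1) :
    contract (minkowski n (1 / c) : (Fin 2 → Fin (n + 1)) → ℂ)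
      (fun i => ((lightDir c (ω : EuclideanSpace ℝ (Fin n)) i : ℝ) : ℂ)) = 0 := by
  have h : ∑ j, (ω : EuclideanSpace ℝ (Fin n)) j ^ 2 = 1 := by
    have := mem_sphere_zero_iff_norm.1 ω.2
    rw [EuclideanSpace.norm_eq, Real.sqrt_eq_one] at this
    simpa using this
  have hc' : (c : ℂ) ≠ 0 := Complex.ofReal_ne_zero.2 hc.ne'
  rw [contract_minkowski]
  simp only [lightDir, Fin.cons_zero, Fin.cons_succ, Algebra.algebraMap_self, RingHom.id_apply]
  have h' : ∑ j, (((ω : EuclideanSpace ℝ (Fin n)) j : ℝ) : ℂ) ^ 2 = 1 := by exact_mod_cast h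
  rw [h']
  push_cast
  field_simp
  ring

end vanishing

/-! ### The conic argument -/

/-- A polynomial which is bounded by a multiple of `|s| ^ k` on the real line is a monomial. -/
lemma exists_eq_C_mul_X_pow_of_norm_eval_le {K : ℝ} {k : ℕ} {N : Polynomial ℂ}
    (h : ∀ s : ℝ, ‖N.eval (s : ℂ)‖ ≤ K * |s| ^ k) :
    ∃ a, N = Polynomial.C a * Polynomial.X ^ k := by
  induction k generalizing N with
  | zero =>
    refine ⟨N.coeff 0, ?_⟩
    rw [pow_zero, mul_one]
    refine Polynomial.eq_C_of_degree_le_zero (not_lt.1 fun hd => ?_)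
    have h1 : Tendsto (fun s : ℝ => ‖(s : ℂ)‖) atTop atTop := by
      simpa using tendsto_abs_atTop_atTop
    obtain ⟨s, hs⟩ := ((N.tendsto_norm_atTop hd h1).eventually_gt_atTop K).exists
    exact absurd (h s) (by simpa using hs)
  | succ k ih =>
    have h0 : N.eval 0 = 0 := by simpa using h 0
    obtain ⟨N', rfl⟩ : Polynomial.X ∣ N := by
      rwa [Polynomial.X_dvd_iff, Polynomial.coeff_zero_eq_eval_zero]
    -- Cancelling `|s|` gives the bound only for `s ≠ 0`; continuity extends it to `s = 0`.
    have hcl : IsClosed {s : ℝ | ‖N'.eval (s : ℂ)‖ ≤ K * |s| ^ k} :=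
      isClosed_le (N'.continuous.comp Complex.continuous_ofReal).norm (by fun_prop)
    have hsub : {(0 : ℝ)}ᶜ ⊆ {s : ℝ | ‖N'.eval (s : ℂ)‖ ≤ K * |s| ^ k} := fun s hs => by
      have hs' : 0 < |s| := abs_pos.2 hs
      have := h s
      rw [Polynomial.eval_mul, Polynomial.eval_X, norm_mul, Complex.norm_real, Real.norm_eq_abs,
        pow_succ, ← mul_assoc, mul_comm] at this
      exact le_of_mul_le_mul_right this hs'
    obtain ⟨a, rfl⟩ := ih fun s => hcl.closure_subset_iff.2 hsub
      ((dense_compl_singleton (0 : ℝ)) s)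
    exact ⟨a, by ring⟩

section

variable {n m : ℕ} {c : ℝ}

/-- The contraction has degree `m` in `v` and the bound has degree `m + 1`; the factor `|v 0|`
balances them, so the estimate scales from light directions to the whole cone. The norm of `K` keeps
the right side nonnegative at `v 0 = 0`. -/
lemma norm_contract_mul_abs_le (hc : 0 < c) {T : (Fin m → Fin (n + 1)) → ℂ} {ξ : Spacetime n}
    {K : ℝ}
    (hT : ∀ ω : Metric.sphere (0 : EuclideanSpace ℝ (Fin n)) 1,
      ‖contract T (fun i => ((lightDir c (ω : EuclideanSpace ℝ (Fin n)) i : ℝ) : ℂ))‖ ≤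
        K * |inner ℝ (lightDir c (ω : EuclideanSpace ℝ (Fin n))) ξ| ^ (m + 1))
    (v : Spacetime n) (hv : c ^ 2 * ∑ j : Fin n, v j.succ ^ 2 = v 0 ^ 2) :
    ‖contract T (fun i => (v i : ℂ))‖ * |v 0| ≤ (‖K‖ * c) * |inner ℝ v ξ| ^ (m + 1) := by
  by_cases hv0 : v 0 = 0
  · rw [hv0, abs_zero, mul_zero]
    positivity
  obtain ⟨ω, hω⟩ := exists_eq_mul_lightDir hc hv0 hv
  set l := v 0 / c with hl
  have h1 : (fun i => (v i : ℂ)) = fun i => (l : ℂ) *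
      ((lightDir c (ω : EuclideanSpace ℝ (Fin n)) i : ℝ) : ℂ) := by
    funext i
    rw [hω i]
    push_cast
    rfl
  have h2 : v = l • lightDir c (ω : EuclideanSpace ℝ (Fin n)) := by
    ext i
    simpa using hω i
  have h3 : |v 0| = |l| * c := by
    rw [hl, abs_div, abs_of_pos hc, div_mul_cancel₀ _ hc.ne']
  rw [h3, h1, contract_smul, norm_mul, norm_pow, Complex.norm_real, Real.norm_eq_abs]
  conv_rhs => rw [h2, inner_smul_left, abs_mul, mul_pow]
  have h4 := (hT ω).trans (mul_le_mul_of_nonneg_right (Real.le_norm_self K) (by positivity))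
  have h5 := mul_le_mul_of_nonneg_left h4 (show 0 ≤ |l| ^ m * (|l| * c) by positivity)
  refine (le_of_eq ?_).trans (h5.trans (le_of_eq ?_))
  · ring
  · simp only [conj_trivial]
    ring

/-- If the contraction of `T` with the light-like directions is bounded by a power larger than `m`
of the pairing with `ξ`, and two distinct light-like directions are orthogonal to `ξ`, then the
contraction vanishes: on the conic through these two directions and a third one it is a
polynomial of degree at most `2m` with two zeros of order greater than `m`. -/
lemma contract_lightDir_eq_zero_of_le (hc : 0 < c) {T : (Fin m → Fin (n + 1)) → ℂ}
    {ξ : Spacetime n} {K : ℝ}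
    (hT : ∀ ω : Metric.sphere (0 : EuclideanSpace ℝ (Fin n)) 1,
      ‖contract T (fun i => ((lightDir c (ω : EuclideanSpace ℝ (Fin n)) i : ℝ) : ℂ))‖ ≤
        K * |inner ℝ (lightDir c (ω : EuclideanSpace ℝ (Fin n))) ξ| ^ (m + 1))
    {a d : Metric.sphere (0 : EuclideanSpace ℝ (Fin n)) 1} (had : a ≠ d)
    (ha : inner ℝ (lightDir c (a : EuclideanSpace ℝ (Fin n))) ξ = 0)
    (hd : inner ℝ (lightDir c (d : EuclideanSpace ℝ (Fin n))) ξ = 0)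
    (u : Metric.sphere (0 : EuclideanSpace ℝ (Fin n)) 1) :
    contract T (fun i => ((lightDir c (u : EuclideanSpace ℝ (Fin n)) i : ℝ) : ℂ)) = 0 := by
  by_cases hua : u = a
  · have := hT u
    rw [hua, ha, abs_zero, zero_pow m.succ_ne_zero, mul_zero] at this
    rw [hua]
    exact norm_le_zero_iff.1 this
  by_cases hud : u = d
  · have := hT u
    rw [hud, hd, abs_zero, zero_pow m.succ_ne_zero, mul_zero] at this
    rw [hud]
    exact norm_le_zero_iff.1 this
  have hne : ∀ x y : Metric.sphere (0 : EuclideanSpace ℝ (Fin n)) 1, x ≠ y →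
      1 - inner ℝ (x : EuclideanSpace ℝ (Fin n)) y ≠ 0 := fun x y hxy h => hxy <| Subtype.ext <|
    (inner_eq_one_iff_of_norm_eq_one (𝕜 := ℝ) (mem_sphere_zero_iff_norm.1 x.2)
      (mem_sphere_zero_iff_norm.1 y.2)).1 (sub_eq_zero.1 h).symm
  set p := 1 - inner ℝ (a : EuclideanSpace ℝ (Fin n)) d with hp
  have hp0 : p ≠ 0 := hne a d had
  set α := (1 - inner ℝ (u : EuclideanSpace ℝ (Fin n)) d) / p with hα
  set β := (1 - inner ℝ (u : EuclideanSpace ℝ (Fin n)) a) / p with hβ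
  have hα0 : α ≠ 0 := div_ne_zero (hne u d hud) hp0
  have hβ0 : β ≠ 0 := div_ne_zero (hne u a hua) hp0
  have hαp : α * p = 1 - inner ℝ (u : EuclideanSpace ℝ (Fin n)) d := div_mul_cancel₀ _ hp0
  have hβp : β * p = 1 - inner ℝ (u : EuclideanSpace ℝ (Fin n)) a := div_mul_cancel₀ _ hp0
  -- A conic in the light cone: `s = 0` gives a multiple of the direction of `a`, `s = 1` that of
  -- `u`, and `s → ∞` tends projectively to that of `d`. The values of `α` and `β` are those that
  -- make the cross terms of the quadratic form cancel for every `s`.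
  let v : ℝ → Spacetime n := fun s => (α * (1 - s)) • lightDir c (a : EuclideanSpace ℝ (Fin n)) +
    s • lightDir c (u : EuclideanSpace ℝ (Fin n)) +
    (β * (s * (s - 1))) • lightDir c (d : EuclideanSpace ℝ (Fin n))
  have hvξ : ∀ s, inner ℝ (v s) ξ =
      s * inner ℝ (lightDir c (u : EuclideanSpace ℝ (Fin n))) ξ := fun s => by
    simp [v, inner_add_left, inner_smul_left, ha, hd]
  have hsum : ∀ x y : EuclideanSpace ℝ (Fin n), ∑ j, x j * y j = inner ℝ x y := fun x y => by
    simp [PiLp.inner_apply, mul_comm]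
  have hone : ∀ x : Metric.sphere (0 : EuclideanSpace ℝ (Fin n)) 1,
      inner ℝ (x : EuclideanSpace ℝ (Fin n)) x = (1 : ℝ) := fun x => by
    rw [real_inner_self_eq_norm_sq, mem_sphere_zero_iff_norm.1 x.2, one_pow]
  have hvnull : ∀ s, c ^ 2 * ∑ j : Fin n, v s j.succ ^ 2 = v s 0 ^ 2 := fun s => by
    have e1 : ∑ j : Fin n, v s j.succ ^ 2 =
        (α * (1 - s)) ^ 2 + s ^ 2 + (β * (s * (s - 1))) ^ 2
          + 2 * (α * (1 - s)) * s * inner ℝ (u : EuclideanSpace ℝ (Fin n)) a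
          + 2 * (α * (1 - s)) * (β * (s * (s - 1))) * inner ℝ (a : EuclideanSpace ℝ (Fin n)) d
          + 2 * s * (β * (s * (s - 1))) * inner ℝ (u : EuclideanSpace ℝ (Fin n)) d := by
      have e2 : ∀ j : Fin n, v s j.succ ^ 2 =
          (α * (1 - s)) ^ 2 * (a.1 j * a.1 j) + s ^ 2 * (u.1 j * u.1 j)
          + (β * (s * (s - 1))) ^ 2 * (d.1 j * d.1 j)
          + 2 * (α * (1 - s)) * s * (u.1 j * a.1 j)
          + 2 * (α * (1 - s)) * (β * (s * (s - 1))) * (a.1 j * d.1 j)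
          + 2 * s * (β * (s * (s - 1))) * (u.1 j * d.1 j) := fun j => by
        simp [v, lightDir]
        ring
      simp only [e2, Finset.sum_add_distrib, ← Finset.mul_sum, hsum, hone, mul_one]
    have e3 : v s 0 = c * (α * (1 - s) + s + β * (s * (s - 1))) := by
      simp [v, lightDir]
      ring
    have e4 : inner ℝ (a : EuclideanSpace ℝ (Fin n)) d = 1 - p := by rw [hp]; ring
    rw [e1, e3, e4, show inner ℝ (u : EuclideanSpace ℝ (Fin n)) d = 1 - α * p by rw [hαp]; ring,
      show inner ℝ (u : EuclideanSpace ℝ (Fin n)) a = 1 - β * p by rw [hβp]; ring]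
    ring
  let x : Fin (n + 1) → Polynomial ℂ := fun i =>
    Polynomial.C ((α * lightDir c (a : EuclideanSpace ℝ (Fin n)) i : ℝ) : ℂ) * (1 - Polynomial.X) +
    Polynomial.C ((lightDir c (u : EuclideanSpace ℝ (Fin n)) i : ℝ) : ℂ) * Polynomial.X +
    Polynomial.C ((β * lightDir c (d : EuclideanSpace ℝ (Fin n)) i : ℝ) : ℂ) *
      (Polynomial.X * (Polynomial.X - 1))
  have hx : ∀ (s : ℝ) i, (x i).eval (s : ℂ) = (v s i : ℂ) := fun s i => by
    simp [x, v]
    ring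
  have hPx : ∀ s : ℝ, (contract T x).eval (s : ℂ) = contract T (fun i => (v s i : ℂ)) := fun s => by
    have := map_contract (Polynomial.aeval (s : ℂ)) T x
    simpa only [Polynomial.coe_aeval_eq_eval, hx] using this
  -- Since `⟨v s, ξ⟩` is linear in `s`, the bound controls both the zero at `s = 0` and the growth
  -- at infinity, so the product is a monomial.
  obtain ⟨k, hk⟩ := exists_eq_C_mul_X_pow_of_norm_eval_le (N := contract T x * x 0) (k := m + 1)
    (K := ‖K‖ * c * |inner ℝ (lightDir c (u : EuclideanSpace ℝ (Fin n))) ξ| ^ (m + 1)) fun s => by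
      rw [Polynomial.eval_mul, hPx, hx, norm_mul, Complex.norm_real, Real.norm_eq_abs]
      refine (norm_contract_mul_abs_le hc hT (v s) (hvnull s)).trans (le_of_eq ?_)
      rw [hvξ, abs_mul, mul_pow]
      ring
  have hx0 : x 0 = Polynomial.C ((c * β : ℝ) : ℂ) * Polynomial.X ^ 2 +
      Polynomial.C ((c * (1 - α - β) : ℝ) : ℂ) * Polynomial.X +
      Polynomial.C ((c * α : ℝ) : ℂ) := by
    simp only [x, lightDir, Fin.cons_zero]
    push_cast
    simp only [map_mul, map_sub, map_one]
    ring
  have hdeg : (x 0).degree = 2 := by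
    rw [hx0]
    exact Polynomial.degree_quadratic (Complex.ofReal_ne_zero.2 (mul_ne_zero hc.ne' hβ0))
  -- The time component has nonzero constant term `c α`, so it has a complex root `z ≠ 0`, where the
  -- monomial `k s ^ (m + 1)` must vanish.
  obtain ⟨z, hz⟩ := Complex.exists_root (f := x 0) (by rw [hdeg]; norm_num)
  have hz0 : z ≠ 0 := by
    rintro rfl
    rw [Polynomial.IsRoot, hx0] at hz
    simp [hc.ne', hα0] at hz
  have hk0 : k = 0 := by
    have := congrArg (Polynomial.eval z) hk
    rw [Polynomial.eval_mul, hz.eq_zero] at this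
    simpa [hz0] using this
  have hP : contract T x = 0 := by
    rw [hk0, map_zero, zero_mul] at hk
    refine (mul_eq_zero.1 hk).resolve_right fun h => ?_
    rw [h] at hdeg
    simp at hdeg
  have := hPx 1
  rw [hP, Polynomial.eval_zero] at this
  simpa [v] using this.symm

/-- Orthogonality to `ξ` places `ω` on the affine hyperplane `⟨η, ω⟩ = -c ξ_0`, which passes at
distance less than one from the origin. As `n ≥ 2`, there is a unit vector `e` orthogonal to `η`,
and moving both ways along `e` from the foot of the perpendicular `κ η` reaches the sphere at two
points. -/
lemma exists_lightDir_orthogonal (hn : 2 ≤ n) {ξ : Spacetime n}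
    (hξ : c ^ 2 * ξ 0 ^ 2 < ∑ j : Fin n, ξ j.succ ^ 2) :
    ∃ a d : Metric.sphere (0 : EuclideanSpace ℝ (Fin n)) 1, a ≠ d ∧
      inner ℝ (lightDir c (a : EuclideanSpace ℝ (Fin n))) ξ = 0 ∧
      inner ℝ (lightDir c (d : EuclideanSpace ℝ (Fin n))) ξ = 0 := by
  let η : EuclideanSpace ℝ (Fin n) := WithLp.toLp 2 fun j => ξ j.succ
  have hη : ‖η‖ ^ 2 = ∑ j : Fin n, ξ j.succ ^ 2 := by
    simp [EuclideanSpace.norm_sq_eq, η]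
  have hη0 : 0 < ‖η‖ ^ 2 := by
    rw [hη]
    exact lt_of_le_of_lt (by positivity) hξ
  obtain ⟨e, he1, he⟩ : ∃ e : EuclideanSpace ℝ (Fin n), ‖e‖ = 1 ∧ inner ℝ η e = 0 := by
    have hne : (Submodule.span ℝ {η})ᗮ ≠ ⊥ := by
      rw [Ne, Submodule.orthogonal_eq_bot_iff]
      intro h
      have h1 := finrank_span_le_card (R := ℝ) ({η} : Set (EuclideanSpace ℝ (Fin n)))
      rw [h, finrank_top, finrank_euclideanSpace_fin] at h1
      simp at h1
      omega
    obtain ⟨e, he, he0⟩ := Submodule.exists_mem_ne_zero_of_ne_bot hne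
    refine ⟨‖e‖⁻¹ • e, by simp [norm_smul, he0], ?_⟩
    rw [inner_smul_right, Submodule.mem_orthogonal_singleton_iff_inner_right.1 he, mul_zero]
  have hpair : ∀ x : EuclideanSpace ℝ (Fin n),
      inner ℝ (lightDir c x) ξ = c * ξ 0 + inner ℝ η x := fun x => by
    simp [PiLp.inner_apply, Fin.sum_univ_succ, lightDir, η, mul_comm]
  set κ := -(c * ξ 0) / ‖η‖ ^ 2 with hκ
  have hκη : κ * ‖η‖ ^ 2 = -(c * ξ 0) := div_mul_cancel₀ _ hη0.ne'
  have hpos : 0 < 1 - κ ^ 2 * ‖η‖ ^ 2 := by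
    rw [← hη] at hξ
    have : κ ^ 2 * ‖η‖ ^ 2 = c ^ 2 * ξ 0 ^ 2 / ‖η‖ ^ 2 := by
      rw [hκ]
      field_simp
    rw [this, sub_pos, div_lt_one hη0]
    exact hξ
  have hnorm : ∀ σ : ℝ, σ ^ 2 = 1 - κ ^ 2 * ‖η‖ ^ 2 → ‖κ • η + σ • e‖ = 1 := fun σ hσ => by
    have : ‖κ • η + σ • e‖ ^ 2 = 1 := by
      rw [norm_add_sq_real, norm_smul, norm_smul, mul_pow, mul_pow, inner_smul_left,
        inner_smul_right, he, he1, Real.norm_eq_abs, Real.norm_eq_abs, sq_abs, sq_abs, hσ]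
      ring
    exact (pow_eq_one_iff_of_nonneg (norm_nonneg _) two_ne_zero).1 this
  have horth : ∀ σ : ℝ, inner ℝ (lightDir c (κ • η + σ • e)) ξ = 0 := fun σ => by
    rw [hpair, inner_add_right, inner_smul_right, inner_smul_right, he,
      real_inner_self_eq_norm_sq, hκη]
    ring
  have hs := Real.sq_sqrt hpos.le
  refine ⟨⟨_, mem_sphere_zero_iff_norm.2 (hnorm _ hs)⟩,
    ⟨_, mem_sphere_zero_iff_norm.2 (hnorm (-√(1 - κ ^ 2 * ‖η‖ ^ 2)) (by rw [neg_sq, hs]))⟩,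
    fun h => ?_, horth _, horth _⟩
  have h1 := congrArg Subtype.val h
  simp only [add_right_inj] at h1
  have h2 := smul_left_injective ℝ (show e ≠ 0 by rintro rfl; simp at he1) h1
  have h3 := Real.sqrt_pos.2 hpos
  linarith

end

/-! ### Vanishing moments on a line -/

/-- After substitution the hypothesis says that `∫ (s - t) ^ m G s` vanishes for all `t`. This is a
polynomial in `t` whose coefficients are nonzero multiples of the moments up to order `m`. -/
lemma moments_eq_zero {m : ℕ} {G : ℝ → ℂ} (hG : Continuous G) (hG' : HasCompactSupport G)
    (h : ∀ t : ℝ, ∫ s : ℝ, (s : ℂ) ^ m * G (s + t) = 0) {k : ℕ} (hk : k ≤ m) :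
    ∫ s : ℝ, (s : ℂ) ^ k * G s = 0 := by
  have hint : ∀ k : ℕ, Integrable fun s : ℝ => (s : ℂ) ^ k * G s := fun k =>
    Continuous.integrable_of_hasCompactSupport (by fun_prop) hG'.mul_left
  let P : Polynomial ℂ := ∑ k ∈ Finset.range (m + 1),
    Polynomial.C ((m.choose k : ℂ) * ∫ s : ℝ, (s : ℂ) ^ k * G s) * Polynomial.X ^ (m - k)
  have hP : ∀ t : ℝ, P.eval ((-t : ℝ) : ℂ) = 0 := fun t => by
    have h1 := integral_add_right_eq_self (μ := volume)
      (fun s : ℝ => ((s - t : ℝ) : ℂ) ^ m * G s) t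
    simp only [add_sub_cancel_right] at h1
    rw [h t] at h1
    rw [h1]
    have h2 : ∀ s : ℝ, ((s - t : ℝ) : ℂ) ^ m * G s = ∑ k ∈ Finset.range (m + 1),
        ((m.choose k : ℂ) * ((-t : ℝ) : ℂ) ^ (m - k)) * ((s : ℂ) ^ k * G s) := fun s => by
      rw [sub_eq_add_neg, Complex.ofReal_add, add_pow, Finset.sum_mul]
      exact Finset.sum_congr rfl fun k _ => by ring
    simp only [h2]
    rw [integral_finsetSum _ fun k _ => (hint k).const_mul _]
    simp only [P, Polynomial.eval_finsetSum, integral_const_mul]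
    refine Finset.sum_congr rfl fun k _ => ?_
    simp
    ring
  have hP0 : P = 0 := by
    refine Polynomial.eq_zero_of_infinite_isRoot P
      ((Set.infinite_range_of_injective Complex.ofReal_injective).mono ?_)
    rintro _ ⟨t, rfl⟩
    simpa using hP (-t)
  have hc : P.coeff (m - k) = (m.choose k : ℂ) * ∫ s : ℝ, (s : ℂ) ^ k * G s := by
    simp only [P, Polynomial.finsetSum_coeff, Polynomial.coeff_C_mul_X_pow]
    rw [Finset.sum_eq_single k]
    · simp
    · intro j hj hjk
      rw [Finset.mem_range] at hj
      rw [if_neg (by omega)]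
    · intro hk'
      exact absurd (Finset.mem_range.2 (by omega)) hk'
  rw [hP0, Polynomial.coeff_zero, eq_comm, mul_eq_zero] at hc
  exact hc.resolve_left (Nat.cast_ne_zero.2 (Nat.choose_pos hk).ne')

/-- The vanishing moments allow the Taylor polynomial of degree `m` to be subtracted from the
exponential; the remainder is of order `m + 1` in `s w`, and the integral runs over an interval of
length `2 ρ`. -/
lemma norm_integral_exp_le {m : ℕ} {G : ℝ → ℂ} (hG : Continuous G) {ρ M : ℝ} (hρ : 0 ≤ ρ)
    (hsupp : ∀ s, ρ < |s| → G s = 0) (hM : ∀ s, ‖G s‖ ≤ M)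
    (h : ∀ k ≤ m, ∫ s : ℝ, (s : ℂ) ^ k * G s = 0) (w : ℂ) :
    ‖∫ s : ℝ, Complex.exp (s * w) * G s‖ ≤
      (ρ * ‖w‖) ^ (m + 1) * Real.exp (ρ * ‖w‖) * M * (2 * ρ) := by
  have hM0 : 0 ≤ M := (norm_nonneg _).trans (hM 0)
  have hG' : HasCompactSupport G := HasCompactSupport.intro (isCompact_Icc (a := -ρ) (b := ρ))
    fun s hs => hsupp s (by
      by_contra hs'
      exact hs (abs_le.1 (not_lt.1 hs')))
  have hint : ∀ k : ℕ, Integrable fun s : ℝ => (s : ℂ) ^ k * G s := fun k =>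
    Continuous.integrable_of_hasCompactSupport (by fun_prop) hG'.mul_left
  have h1 : ∫ s : ℝ, Complex.exp (s * w) * G s = ∫ s : ℝ, (Complex.exp (s * w) -
      ∑ k ∈ Finset.range (m + 1), (s * w) ^ k / (k.factorial : ℂ)) * G s := by
    have e : ∀ s : ℝ, (∑ k ∈ Finset.range (m + 1), (s * w) ^ k / (k.factorial : ℂ)) * G s =
        ∑ k ∈ Finset.range (m + 1), (w ^ k / (k.factorial : ℂ)) * ((s : ℂ) ^ k * G s) :=
      fun s => by
        rw [Finset.sum_mul]
        exact Finset.sum_congr rfl fun k _ => by ring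
    simp only [sub_mul, e]
    rw [integral_sub, integral_finsetSum _ fun k _ => (hint k).const_mul _,
      Finset.sum_eq_zero, sub_zero]
    · intro k hk
      rw [integral_const_mul, h k (Nat.lt_succ_iff.1 (Finset.mem_range.1 hk)), mul_zero]
    · exact Continuous.integrable_of_hasCompactSupport (by fun_prop) hG'.mul_left
    · exact integrable_finsetSum _ fun k _ => (hint k).const_mul _
  rw [h1, ← setIntegral_eq_integral_of_forall_compl_eq_zero (s := Set.Icc (-ρ) ρ)]
  · have hvol : volume.real (Set.Icc (-ρ) ρ) = 2 * ρ := by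
      rw [Real.volume_real_Icc_of_le (by linarith)]
      ring
    rw [← hvol]
    refine norm_setIntegral_le_of_norm_le_const (by simp) fun s hs => ?_
    have hs' : |s| ≤ ρ := abs_le.2 hs
    rw [norm_mul]
    have hsw : ‖(s : ℂ) * w‖ ≤ ρ * ‖w‖ := by
      rw [norm_mul, Complex.norm_real, Real.norm_eq_abs]
      gcongr
    refine mul_le_mul ((Complex.norm_exp_sub_sum_le_norm_mul_exp _ _).trans ?_) (hM s)
      (norm_nonneg _) (by positivity)
    gcongr
  · intro s hs
    rw [hsupp s (by
      by_contra hs'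
      exact hs (abs_le.1 (not_lt.1 hs'))), mul_zero]

/-! ### Fourier transforms of compactly supported functions -/

section

variable {E : Type*} [NormedAddCommGroup E] [InnerProductSpace ℝ E] [FiniteDimensional ℝ E]
  [MeasurableSpace E] [BorelSpace E]

/-- Integration along the lines of direction `v`, weighted by a function of a transversal
coordinate of integral one. -/
lemma integral_eq_integral_lines {G : E → ℂ} (hG : Continuous G) (hG' : HasCompactSupport G)
    {ψ : ℝ → ℝ} (hψ : Continuous ψ) (hψ' : HasCompactSupport ψ) (hψ1 : ∫ r, ψ r = 1)
    {l : E →L[ℝ] ℝ} {v : E} (hv : l v = 1) :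
    ∫ q, G q = ∫ q, (ψ (l q) : ℂ) * ∫ r : ℝ, G (q + r • v) := by
  let F : E × ℝ → ℂ := fun p => (ψ p.2 : ℂ) * G p.1
  have hF : Continuous F := by fun_prop
  have hF' : HasCompactSupport F := by
    refine HasCompactSupport.intro (hG'.isCompact.prod hψ'.isCompact) fun p hp => ?_
    rw [Set.mem_prod, not_and_or] at hp
    rcases hp with hp | hp
    · simp [F, image_eq_zero_of_notMem_tsupport hp]
    · simp [F, image_eq_zero_of_notMem_tsupport hp]
  -- Both integrands below are `F` composed with a homeomorphism of `E × ℝ`, hence compactly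
  -- supported, which justifies exchanging the integrals.
  let e₁ : E × ℝ ≃ₜ E × ℝ :=
    { toFun := fun p => (p.1 + p.2 • v, l p.1)
      invFun := fun p => (p.1 - (l p.1 - p.2) • v, l p.1 - p.2)
      left_inv := fun p => by simp [hv]
      right_inv := fun p => by simp [hv]
      continuous_toFun := by fun_prop
      continuous_invFun := by fun_prop }
  let e₂ : E × ℝ ≃ₜ E × ℝ :=
    { toFun := fun p => (p.1, l p.1 - p.2)
      invFun := fun p => (p.1, l p.1 - p.2)
      left_inv := fun p => by simp
      right_inv := fun p => by simp
      continuous_toFun := by fun_prop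
      continuous_invFun := by fun_prop }
  have s₁ : ∫ q, ∫ r : ℝ, (ψ (l q) : ℂ) * G (q + r • v) =
      ∫ r : ℝ, ∫ q, (ψ (l q) : ℂ) * G (q + r • v) :=
    integral_integral_swap_of_hasCompactSupport (f := fun q (r : ℝ) => (ψ (l q) : ℂ) * G (q + r • v))
      (hF.comp e₁.continuous) (hF'.comp_homeomorph e₁)
  have s₂ : ∫ q, ∫ r : ℝ, (ψ (l q - r) : ℂ) * G q = ∫ r : ℝ, ∫ q, (ψ (l q - r) : ℂ) * G q :=
    integral_integral_swap_of_hasCompactSupport (f := fun q (r : ℝ) => (ψ (l q - r) : ℂ) * G q)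
      (hF.comp e₂.continuous) (hF'.comp_homeomorph e₂)
  have s₃ : ∀ r : ℝ, ∫ q, (ψ (l q) : ℂ) * G (q + r • v) = ∫ q, (ψ (l q - r) : ℂ) * G q :=
    fun r => by
      rw [← integral_add_right_eq_self (μ := volume) (fun q => (ψ (l q - r) : ℂ) * G q) (r • v)]
      simp [hv]
  simp only [← integral_const_mul]
  rw [s₁]
  simp only [s₃]
  rw [← s₂]
  refine integral_congr_ae (ae_of_all _ fun q => ?_)
  simp only [integral_mul_const]
  rw [integral_sub_left_eq_self (fun r => (ψ r : ℂ)) volume (l q), integral_complex_ofReal, hψ1]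
  simp

lemma exists_bump : ∃ ψ : ℝ → ℝ, Continuous ψ ∧ HasCompactSupport ψ ∧ ∫ r, ψ r = 1 ∧
    ∀ r, 1 < |r| → ψ r = 0 := by
  let b : ContDiffBump (0 : ℝ) := ⟨1 / 2, 1, by norm_num, by norm_num⟩
  refine ⟨b.normed volume, (b.contDiff_normed (n := 0)).continuous, b.hasCompactSupport_normed,
    b.integral_normed, fun r hr => ?_⟩
  rw [← Function.notMem_support, b.support_normed_eq]
  simpa [b] using hr.le

/-- If the moments up to order `m` of a function along all lines of direction `v` vanish, then its
Fourier transform vanishes to order `m + 1` on the hyperplane orthogonal to `v`. -/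
lemma exists_norm_fourier_le (m : ℕ) (R M V : ℝ) (hR : 0 ≤ R) (l : E →L[ℝ] ℝ) (ξ : E) :
    ∃ K : ℝ, ∀ (g : E → ℂ) (v : E), Continuous g → (∀ q, R < ‖q‖ → g q = 0) → (∀ q, ‖g q‖ ≤ M) →
      l v = 1 → ‖v‖ ≤ V → (∀ q, ∀ k ≤ m, ∫ r : ℝ, (r : ℂ) ^ k * g (q + r • v) = 0) →
      ‖𝓕 g ξ‖ ≤ K * |inner ℝ v ξ| ^ (m + 1) := by
  obtain ⟨ψ, hψ, hψ', hψ1, hψs⟩ := exists_bump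
  obtain ⟨Ψ, hΨ⟩ := hψ'.exists_bound_of_continuous hψ
  -- All constants are fixed before `g` and `v`, so that one `K` serves every direction. For `|l q|
  -- ≤ 1`, the line through `q` meets the ball of radius `R` only at parameters `|r| ≤ ρ`, because
  -- `r = l (q + r • v) - l q`.
  obtain ⟨ρ, hρl⟩ : ∃ ρ, ρ = ‖l‖ * R + 1 := ⟨_, rfl⟩
  have hρ : 0 ≤ ρ := by rw [hρl]; positivity
  obtain ⟨W, hW⟩ : ∃ W : ℝ, W = 2 * Real.pi * (V * ‖ξ‖) := ⟨_, rfl⟩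
  obtain ⟨A, hA⟩ : ∃ A : ℝ, A = (ρ * (2 * Real.pi)) ^ (m + 1) * Real.exp (ρ * W) * M * (2 * ρ) := ⟨_, rfl⟩
  obtain ⟨B, hB⟩ : ∃ B : ℝ, B = volume.real (Metric.closedBall (0 : E) (R + ρ * V)) := ⟨_, rfl⟩
  refine ⟨Ψ * A * B, fun g v hg hgR hgM hlv hvV hmom => ?_⟩
  have hM0 : 0 ≤ M := (norm_nonneg _).trans (hgM 0)
  have hΨ0 : 0 ≤ Ψ := (norm_nonneg _).trans (hΨ 0)
  have hV0 : 0 ≤ V := (norm_nonneg _).trans hvV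
  have hg' : HasCompactSupport g := HasCompactSupport.intro (isCompact_closedBall (0 : E) R)
    fun q hq => hgR q (by simpa using hq)
  have hA0 : 0 ≤ A := by rw [hA]; positivity
  have hcont : Continuous fun q : E =>
      Complex.exp (↑(-2 * Real.pi * inner ℝ q ξ) * Complex.I) * g q := by fun_prop
  have key := integral_eq_integral_lines hcont hg'.mul_left hψ hψ' hψ1 hlv
  rw [Real.fourier_eq']
  simp only [smul_eq_mul]
  rw [key]
  set w : ℂ := ↑(-2 * Real.pi * inner ℝ v ξ) * Complex.I with hw
  have hwn : ‖w‖ = 2 * Real.pi * |inner ℝ v ξ| := by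
    rw [hw, norm_mul, Complex.norm_I, mul_one, Complex.norm_real, Real.norm_eq_abs, abs_mul,
      abs_mul, abs_neg, abs_two, abs_of_pos Real.pi_pos]
  have hwW : ‖w‖ ≤ W := by
    rw [hwn, hW]
    refine mul_le_mul_of_nonneg_left ((abs_real_inner_le_norm v ξ).trans ?_) (by positivity)
    gcongr
  have hline : ∀ q (r : ℝ), Complex.exp (↑(-2 * Real.pi * inner ℝ (q + r • v) ξ) * Complex.I) *
      g (q + r • v) = Complex.exp (↑(-2 * Real.pi * inner ℝ q ξ) * Complex.I) *
        (Complex.exp (r * w) * g (q + r • v)) := fun q r => by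
    rw [← mul_assoc, ← Complex.exp_add, hw, inner_add_left, inner_smul_left]
    congr 2
    simp
    ring
  have hr : ∀ q (r : ℝ), |l q| ≤ 1 → ρ < |r| → g (q + r • v) = 0 := fun q r hq hr => by
    refine hgR _ (not_le.1 fun h => hr.not_ge ?_)
    have h1 : r = l (q + r • v) - l q := by simp [hlv]
    have h2 : |l (q + r • v)| ≤ ‖l‖ * R := (l.le_opNorm _).trans (by gcongr)
    rw [h1, hρl]
    exact (abs_sub _ _).trans (add_le_add h2 hq)
  have hbound : ∀ q, |l q| ≤ 1 →
      ‖∫ r : ℝ, Complex.exp (↑(-2 * Real.pi * inner ℝ (q + r • v) ξ) * Complex.I) *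
        g (q + r • v)‖ ≤ A * |inner ℝ v ξ| ^ (m + 1) := fun q hq => by
    simp only [hline]
    rw [integral_const_mul, norm_mul, Complex.norm_exp_ofReal_mul_I, one_mul]
    refine (norm_integral_exp_le (G := fun r : ℝ => g (q + r • v)) (by fun_prop) hρ
      (fun r => hr q r hq) (fun r => hgM _) (hmom q) w).trans ?_
    have h1 : (ρ * ‖w‖) ^ (m + 1) * Real.exp (ρ * ‖w‖) * M * (2 * ρ) ≤
        (ρ * ‖w‖) ^ (m + 1) * Real.exp (ρ * W) * M * (2 * ρ) := by
      gcongr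
    refine h1.trans (le_of_eq ?_)
    rw [hwn, ← mul_assoc, mul_pow]
    rw [hA]
    ring
  -- The weight restricts `q` to `|l q| ≤ 1`, and then a line that meets the support starts within
  -- `R + ρ V` of the origin.
  rw [← setIntegral_eq_integral_of_forall_compl_eq_zero
    (s := Metric.closedBall (0 : E) (R + ρ * V))]
  · refine (norm_setIntegral_le_of_norm_le_const (C := Ψ * (A * |inner ℝ v ξ| ^ (m + 1)))
      measure_closedBall_lt_top fun q _ => ?_).trans (le_of_eq (by rw [hB]; ring))
    rw [norm_mul, Complex.norm_real]
    by_cases hq : |l q| ≤ 1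
    · exact mul_le_mul (hΨ _) (hbound q hq) (norm_nonneg _) hΨ0
    · rw [hψs _ (not_le.1 hq), norm_zero, zero_mul]
      positivity
  · intro q hq
    by_cases hq1 : |l q| ≤ 1
    · have : ∀ r : ℝ, g (q + r • v) = 0 := fun r => by
        by_cases hrρ : ρ < |r|
        · exact hr q r hq1 hrρ
        · refine hgR _ (not_le.1 fun h => hq ?_)
          rw [mem_closedBall_zero_iff]
          calc ‖q‖ = ‖(q + r • v) - r • v‖ := by rw [add_sub_cancel_right]
            _ ≤ ‖q + r • v‖ + ‖r • v‖ := norm_sub_le _ _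
            _ ≤ R + ρ * V := by
              rw [norm_smul, Real.norm_eq_abs]
              exact add_le_add h (mul_le_mul (not_lt.1 hrρ) hvV (norm_nonneg _) hρ)
      simp [this]
    · rw [hψs _ (not_le.1 hq1), Complex.ofReal_zero, zero_mul]

/-- Differentiation under the integral sign, dominated on a unit disc. This extends the Fourier
transform along a real line to an entire function. -/
lemma differentiable_integral_exp {g b : E → ℂ} (hg : Continuous g) (hg' : HasCompactSupport g)
    (hb : Continuous b) : Differentiable ℂ fun z : ℂ => ∫ q, Complex.exp (z * b q) * g q := by
  intro z
  refine (hasDerivAt_integral_of_dominated_loc_of_deriv_le (Metric.ball_mem_nhds z one_pos)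
    (bound := fun q => Real.exp ((‖z‖ + 1) * ‖b q‖) * ‖b q‖ * ‖g q‖)
    (F' := fun z q => Complex.exp (z * b q) * b q * g q)
    (Eventually.of_forall fun w => ?_) ?_ ?_ (ae_of_all _ fun q w hw => ?_) ?_
    (ae_of_all _ fun q w _ => ?_)).2.differentiableAt
  · exact Continuous.aestronglyMeasurable (by fun_prop)
  · exact Continuous.integrable_of_hasCompactSupport (by fun_prop) hg'.mul_left
  · exact Continuous.aestronglyMeasurable (by fun_prop)
  · have hw' : ‖w‖ ≤ ‖z‖ + 1 := by
      have h1 := norm_le_norm_add_norm_sub' w z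
      have h2 := mem_ball_iff_norm.1 hw
      linarith
    rw [norm_mul, norm_mul]
    gcongr
    refine (Complex.norm_exp_le_exp_norm _).trans (Real.exp_le_exp.2 ?_)
    rw [norm_mul]
    gcongr
  · exact Continuous.integrable_of_hasCompactSupport (by fun_prop) hg'.norm.mul_left
  · simpa using (((hasDerivAt_id w).mul_const (b q)).cexp).mul_const (g q)

/-- A continuous compactly supported function vanishes if its Fourier transform vanishes on a
nonempty open set. -/
lemma eq_zero_of_fourier_eq_zero_on {g : E → ℂ} (hg : Continuous g) (hg' : HasCompactSupport g)
    {U : Set E} (hU : IsOpen U) (hne : U.Nonempty) (h : ∀ ξ ∈ U, 𝓕 g ξ = 0) : g = 0 := by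
  obtain ⟨ξ₀, hξ₀⟩ := hne
  have hF : 𝓕 g = 0 := by
    funext ξ
    -- `H` extends the transform along the line from `ξ₀` to `ξ`. It vanishes at real parameters
    -- near `0`, hence everywhere, in particular at `1`.
    let H : ℂ → ℂ := fun z => ∫ q,
      Complex.exp (z * (↑(-2 * Real.pi * inner ℝ q (ξ - ξ₀)) * Complex.I)) *
        (Complex.exp (↑(-2 * Real.pi * inner ℝ q ξ₀) * Complex.I) * g q)
    have hH : Differentiable ℂ H :=
      differentiable_integral_exp (by fun_prop) hg'.mul_left (by fun_prop)
    have hHt : ∀ t : ℝ, H t = 𝓕 g (ξ₀ + t • (ξ - ξ₀)) := fun t => by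
      rw [Real.fourier_eq']
      refine integral_congr_ae (ae_of_all _ fun q => ?_)
      simp only [smul_eq_mul]
      rw [← mul_assoc, ← Complex.exp_add, inner_add_right, inner_smul_right]
      congr 2
      push_cast
      ring
    have hfreq : ∃ᶠ z in 𝓝[≠] (0 : ℂ), H z = 0 := by
      have h1 : ∀ᶠ t in 𝓝 (0 : ℝ), ξ₀ + t • (ξ - ξ₀) ∈ U := by
        have hc : Continuous fun t : ℝ => ξ₀ + t • (ξ - ξ₀) := by fun_prop
        exact hc.continuousAt.eventually_mem (hU.mem_nhds (by simpa using hξ₀))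
      have h2 : ∃ᶠ t : ℝ in 𝓝[≠] (0 : ℝ), H t = 0 := ((h1.filter_mono nhdsWithin_le_nhds).mono
        fun t ht => by rw [hHt, h _ ht]).frequently
      have h3 : Tendsto (fun t : ℝ => (t : ℂ)) (𝓝[≠] 0) (𝓝[≠] 0) := by
        refine tendsto_nhdsWithin_iff.2 ⟨?_, ?_⟩
        · exact (Complex.continuous_ofReal.tendsto' 0 0 rfl).mono_left nhdsWithin_le_nhds
        · filter_upwards [self_mem_nhdsWithin] with t ht
          simpa using ht
      exact h3.frequently h2
    have hz := (hH.differentiableOn.analyticOnNhd isOpen_univ).eqOn_zero_of_preconnected_of_frequently_eq_zero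
      isPreconnected_univ (Set.mem_univ 0) hfreq (Set.mem_univ (1 : ℂ))
    have h1 := hHt 1
    rw [Complex.ofReal_one, hz] at h1
    simpa using h1.symm
  have hinv := hg.fourierInv_fourier_eq (hg.integrable_of_hasCompactSupport hg') (by
    rw [hF]
    exact integrable_zero _ _ _)
  rw [← hinv, hF]
  funext x
  simp [Real.fourierInv_eq']

end

/-! ### Application to the momentum light ray transform -/

variable {n m : ℕ} {c : ℝ}

lemma norm_lightDir (c : ℝ) (ω : Metric.sphere (0 : EuclideanSpace ℝ (Fin n)) 1) :
    ‖lightDir c (ω : EuclideanSpace ℝ (Fin n))‖ = √(c ^ 2 + 1) := by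
  have h := mem_sphere_zero_iff_norm.1 ω.2
  rw [EuclideanSpace.norm_eq, Real.sqrt_eq_one] at h
  rw [EuclideanSpace.norm_eq, Fin.sum_univ_succ]
  simp only [Real.norm_eq_abs, sq_abs] at h
  simp only [lightDir, Fin.cons_zero, Fin.cons_succ, Real.norm_eq_abs, sq_abs, h]

lemma lightDir_ne_zero (hc : 0 < c) (ω : EuclideanSpace ℝ (Fin n)) : lightDir c ω ≠ 0 := fun h => by
  have := congrArg (fun v : Spacetime n => v 0) h
  simp [lightDir, hc.ne'] at this

lemma hasCompactSupport_line {E F : Type*} [NormedAddCommGroup E] [NormedSpace ℝ E] [Zero F]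
    {g : E → F} (hg : HasCompactSupport g) (q : E) {v : E} (hv : v ≠ 0) :
    HasCompactSupport fun r : ℝ => g (q + r • v) :=
  hg.comp_isClosedEmbedding
    ((Homeomorph.addLeft q).isClosedEmbedding.comp (isClosedEmbedding_smul_left hv))

lemma continuous_component {f : Spacetime n → SymTensor n m} (hf : Continuous f)
    (i : Fin m → Fin (n + 1)) :
    Continuous fun q => (f q : (Fin m → Fin (n + 1)) → ℂ) i :=
  (continuous_apply i).comp (continuous_subtype_val.comp hf)

lemma hasCompactSupport_component {f : Spacetime n → SymTensor n m} (hf : HasCompactSupport f)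
    (i : Fin m → Fin (n + 1)) :
    HasCompactSupport fun q => (f q : (Fin m → Fin (n + 1)) → ℂ) i :=
  hf.comp_left (g := fun T : SymTensor n m => (T : (Fin m → Fin (n + 1)) → ℂ) i) rfl

lemma continuous_contract {f : Spacetime n → SymTensor n m} (hf : Continuous f)
    (x : Fin (n + 1) → ℂ) :
    Continuous fun q => contract (f q : (Fin m → Fin (n + 1)) → ℂ) x :=
  continuous_finsetSum _ fun i _ => (continuous_component hf i).mul continuous_const

lemma contract_zero (x : Fin (n + 1) → ℂ) :
    contract (0 : (Fin m → Fin (n + 1)) → ℂ) x = 0 := by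
  simp [contract]

lemma hasCompactSupport_contract {f : Spacetime n → SymTensor n m} (hf : HasCompactSupport f)
    (x : Fin (n + 1) → ℂ) :
    HasCompactSupport fun q => contract (f q : (Fin m → Fin (n + 1)) → ℂ) x :=
  hf.comp_left (g := fun T : SymTensor n m => contract (T : (Fin m → Fin (n + 1)) → ℂ) x)
    (contract_zero x)

lemma mlrt_eq_integral_contract (hc : 0 < c) {f : Spacetime n → SymTensor n m} (hf : Continuous f)
    (hf' : HasCompactSupport f) (k : ℕ) (p : Spacetime n) (ω : EuclideanSpace ℝ (Fin n)) :
    mlrt c k f p ω = ∫ s : ℝ, (s : ℂ) ^ k *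
      contract (f (p + s • lightDir c ω) : (Fin m → Fin (n + 1)) → ℂ)
        (fun i => ((lightDir c ω i : ℝ) : ℂ)) := by
  simp only [mlrt, contract, Finset.mul_sum, ← integral_const_mul]
  rw [integral_finsetSum]
  · refine Finset.sum_congr rfl fun i _ => integral_congr_ae (ae_of_all _ fun s => ?_)
    simp only [Algebra.algebraMap_self, RingHom.id_apply]
    ring
  · intro i _
    have h1 := continuous_component hf i
    refine Continuous.integrable_of_hasCompactSupport ?_ ?_
    · have : Continuous fun s : ℝ =>
          (f (p + s • lightDir c ω) : (Fin m → Fin (n + 1)) → ℂ) i :=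
        h1.comp (by fun_prop)
      simp only [Algebra.algebraMap_self, RingHom.id_apply]
      fun_prop
    · exact HasCompactSupport.mul_left (HasCompactSupport.mul_right
        (hasCompactSupport_line (hasCompactSupport_component hf' i) p (lightDir_ne_zero hc ω)))

lemma norm_contract_le {T : (Fin m → Fin (n + 1)) → ℂ} {x : Fin (n + 1) → ℂ} {A V : ℝ}
    (hA : ‖T‖ ≤ A) (hV : ∀ i, ‖x i‖ ≤ V) :
    ‖contract T x‖ ≤ ∑ _i : Fin m → Fin (n + 1), A * V ^ m := by
  have hA0 := (norm_nonneg _).trans hA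
  refine norm_sum_le_of_le _ fun i _ => ?_
  rw [norm_mul, norm_prod]
  refine mul_le_mul ((norm_le_pi_norm T i).trans hA) ?_ (by positivity) hA0
  refine (Finset.prod_le_prod (fun j _ => norm_nonneg _) fun j _ => hV (i j)).trans (le_of_eq ?_)
  simp

lemma fourier_contract {f : Spacetime n → SymTensor n m} (hf : Continuous f)
    (hf' : HasCompactSupport f) (x : Fin (n + 1) → ℂ) (ξ : Spacetime n) :
    𝓕 (fun q => contract (f q : (Fin m → Fin (n + 1)) → ℂ) x) ξ =
      contract (fun i => 𝓕 (fun q => (f q : (Fin m → Fin (n + 1)) → ℂ) i) ξ) x := by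
  simp only [Real.fourier_eq', contract, smul_eq_mul, Finset.mul_sum]
  rw [integral_finsetSum]
  · refine Finset.sum_congr rfl fun i _ => ?_
    simp only [Algebra.algebraMap_self, RingHom.id_apply]
    rw [← integral_mul_const]
    refine integral_congr_ae (ae_of_all _ fun s => ?_)
    ring
  · intro i _
    have h1 := continuous_component hf i
    refine Continuous.integrable_of_hasCompactSupport ?_ ?_
    · simp only [Algebra.algebraMap_self, RingHom.id_apply]
      fun_prop
    · exact HasCompactSupport.mul_left (HasCompactSupport.mul_right
        (hasCompactSupport_component hf' i))

/-- A tensor field in the kernel of the momentum light ray transform of order `m` is annihilated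
by all light-like directions. -/
lemma contract_eq_zero_of_mlrt_eq_zero (hn : 2 ≤ n) (hc : 0 < c) {f : Spacetime n → SymTensor n m}
    (hf : Continuous f) (hf' : HasCompactSupport f)
    (h : ∀ (p : Spacetime n) (ω : Metric.sphere (0 : EuclideanSpace ℝ (Fin n)) 1),
      sphereMlrt c m f p ω = 0) (q : Spacetime n)
    (ω : Metric.sphere (0 : EuclideanSpace ℝ (Fin n)) 1) :
    contract (f q : (Fin m → Fin (n + 1)) → ℂ)
      (fun i => ((lightDir c (ω : EuclideanSpace ℝ (Fin n)) i : ℝ) : ℂ)) = 0 := by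
  let x : Metric.sphere (0 : EuclideanSpace ℝ (Fin n)) 1 → Fin (n + 1) → ℂ := fun ω i =>
    ((lightDir c (ω : EuclideanSpace ℝ (Fin n)) i : ℝ) : ℂ)
  let g : Metric.sphere (0 : EuclideanSpace ℝ (Fin n)) 1 → Spacetime n → ℂ := fun ω q =>
    contract (f q : (Fin m → Fin (n + 1)) → ℂ) (x ω)
  have hg : ∀ ω, Continuous (g ω) := fun ω => continuous_contract hf _
  have hg' : ∀ ω, HasCompactSupport (g ω) := fun ω => hasCompactSupport_contract hf' _
  have hmom : ∀ ω q, ∀ k ≤ m, ∫ r : ℝ, (r : ℂ) ^ k *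
      g ω (q + r • lightDir c (ω : EuclideanSpace ℝ (Fin n))) = 0 := fun ω q k hk => by
    refine moments_eq_zero (m := m) ((hg ω).comp (by fun_prop))
      (hasCompactSupport_line (hg' ω) q (lightDir_ne_zero hc _)) (fun t => ?_) hk
    have h1 := h (q + t • lightDir c (ω : EuclideanSpace ℝ (Fin n))) ω
    rw [sphereMlrt, mlrt_eq_integral_contract hc hf hf'] at h1
    rw [← h1]
    refine integral_congr_ae (ae_of_all _ fun s => ?_)
    simp only [g, x, Function.comp_apply, add_smul, add_assoc, add_comm (s • _)]
  obtain ⟨A, hA⟩ := hf'.exists_bound_of_continuous hf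
  obtain ⟨R, hR⟩ := hf'.isCompact.isBounded.subset_closedBall (0 : Spacetime n)
  have hV : ∀ ω i, ‖x ω i‖ ≤ √(c ^ 2 + 1) := fun ω i => by
    rw [← norm_lightDir c ω, Complex.norm_real]
    exact PiLp.norm_apply_le _ i
  have hbound : ∀ ξ : Spacetime n, ∃ K : ℝ, ∀ ω,
      ‖contract (fun i => 𝓕 (fun q => (f q : (Fin m → Fin (n + 1)) → ℂ) i) ξ) (x ω)‖ ≤
        K * |inner ℝ (lightDir c (ω : EuclideanSpace ℝ (Fin n))) ξ| ^ (m + 1) := fun ξ => by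
    -- The functional `c⁻¹ x_0` equals one on every light direction and all light directions have
    -- the same norm, so `K` does not depend on `ω`.
    obtain ⟨K, hK⟩ := exists_norm_fourier_le (E := Spacetime n) m (max R 0)
      (∑ _i : Fin m → Fin (n + 1), A * √(c ^ 2 + 1) ^ m) (√(c ^ 2 + 1)) (le_max_right _ _)
      (c⁻¹ • EuclideanSpace.proj 0) ξ
    refine ⟨K, fun ω => ?_⟩
    rw [← fourier_contract hf hf']
    refine hK (g ω) (lightDir c (ω : EuclideanSpace ℝ (Fin n))) (hg ω) (fun q hq => ?_)
      (fun q => norm_contract_le (hA q) (hV ω)) ?_ (norm_lightDir c ω).le (hmom ω)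
    · have hq' : q ∉ tsupport f := fun hq' => by
        have := mem_closedBall_zero_iff.1 (hR hq')
        exact absurd ((le_max_left R 0).trans_lt hq) (not_lt.2 this)
      simp only [g, image_eq_zero_of_notMem_tsupport hq']
      exact contract_zero _
    · simp [lightDir, hc.ne']
  have hU : IsOpen {ξ : Spacetime n | c ^ 2 * ξ 0 ^ 2 < ∑ j : Fin n, ξ j.succ ^ 2} :=
    isOpen_lt (by fun_prop) (by fun_prop)
  have hne : {ξ : Spacetime n | c ^ 2 * ξ 0 ^ 2 < ∑ j : Fin n, ξ j.succ ^ 2}.Nonempty := by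
    refine ⟨WithLp.toLp 2 (Fin.cons 0 fun _ => 1), ?_⟩
    simp
    omega
  have := eq_zero_of_fourier_eq_zero_on (hg ω) (hg' ω) hU hne fun ξ hξ => by
    obtain ⟨K, hK⟩ := hbound ξ
    obtain ⟨a, d, had, ha, hd⟩ := exists_lightDir_orthogonal hn hξ
    rw [fourier_contract hf hf']
    exact contract_lightDir_eq_zero_of_le hc hK had ha hd ω
  exact congrFun this q

/-- A surjection of vector spaces onto its range has a linear section, which extends to the whole
target. Applied pointwise, it gives a preimage field that depends linearly on `f`, so smoothness and
compact support carry over. -/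
lemma exists_linearMap_apply_eq {V W : Type*} [AddCommGroup V] [Module ℂ V] [AddCommGroup W]
    [Module ℂ W] (A : V →ₗ[ℂ] W) : ∃ B : W →ₗ[ℂ] V, ∀ w ∈ LinearMap.range A, A (B w) = w := by
  obtain ⟨B, hB⟩ := A.rangeRestrict.exists_rightInverse_of_surjective A.range_rangeRestrict
  obtain ⟨B', hB'⟩ := B.exists_extend
  refine ⟨B', fun w hw => ?_⟩
  have h : B' w = B ⟨w, hw⟩ := LinearMap.congr_fun hB' ⟨w, hw⟩
  rw [h]
  exact congrArg Subtype.val (LinearMap.congr_fun hB ⟨w, hw⟩)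

lemma comp_mem_CcField {k : ℕ} (B : SymTensor n m →ₗ[ℂ] SymTensor n k)
    {f : Spacetime n → SymTensor n m} (hf : f ∈ CcField n m) : (fun p => B (f p)) ∈ CcField n k :=
  ⟨((B.toContinuousLinearMap.restrictScalars ℝ).contDiff).comp hf.1, hf.2.comp_left B.map_zero⟩

end LightRay

theorem theorem2 (n : ℕ) (hn : 2 ≤ n) (c : ℝ) (hc : 0 < c) :
    -- rank 0 and rank 1: the transform is injective
    (∀ m : ℕ, m = 0 ∨ m = 1 → ∀ f ∈ LightRay.CcField n m,
      (∀ (p : LightRay.Spacetime n) (ω : Metric.sphere (0 : EuclideanSpace ℝ (Fin n)) 1),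
        LightRay.sphereMlrt c m f p ω = 0) →
      f = 0) ∧
    -- rank m ≥ 2, written as m = r + 2
    (∀ r : ℕ, ∀ f ∈ LightRay.CcField n (r + 2),
      (∀ (p : LightRay.Spacetime n) (ω : Metric.sphere (0 : EuclideanSpace ℝ (Fin n)) 1),
        LightRay.sphereMlrt c (r + 2) f p ω = 0) →
      ∃ h ∈ LightRay.CcField n r,
        f = fun p => LightRay.symMul (LightRay.minkowski n (1 / c)) (h p)) ∧
    -- the converse, for the moments of every order k
    (∀ r : ℕ, ∀ h ∈ LightRay.CcField n r,
      (fun p => LightRay.symMul (LightRay.minkowski n (1 / c)) (h p)) ∈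
          LightRay.CcField n (r + 2) ∧
      ∀ (k : ℕ) (p : LightRay.Spacetime n)
        (ω : Metric.sphere (0 : EuclideanSpace ℝ (Fin n)) 1),
        LightRay.sphereMlrt c k
          (fun q => LightRay.symMul (LightRay.minkowski n (1 / c)) (h q)) p ω = 0) := by
  have hn0 : 0 < n := by omega
  refine ⟨fun m hm f hf h => ?_, fun r f hf h => ?_, fun r h hh => ?_⟩
  · funext q
    exact LightRay.eq_zero_of_contract_lightDir_eq_zero hn0 hc (by omega) (f q)
      (LightRay.contract_eq_zero_of_mlrt_eq_zero hn hc hf.1.continuous hf.2 h q)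
  · obtain ⟨B, hB⟩ := LightRay.exists_linearMap_apply_eq
      (LightRay.symMulLin r (LightRay.minkowski n (1 / c)))
    refine ⟨fun q => B (f q), LightRay.comp_mem_CcField B hf, ?_⟩
    funext q
    exact (hB (f q) (LightRay.mem_range_symMulLin hn0 hc (f q)
      (LightRay.contract_eq_zero_of_mlrt_eq_zero hn hc hf.1.continuous hf.2 h q))).symm
  · have hmem := LightRay.comp_mem_CcField
      (LightRay.symMulLin r (LightRay.minkowski n (1 / c))) hh
    refine ⟨hmem, fun k p ω => ?_⟩
    refine (LightRay.mlrt_eq_integral_contract hc hmem.1.continuous hmem.2 k p ω).trans ?_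
    refine (integral_congr_ae (ae_of_all _ fun s => ?_)).trans (integral_zero ℝ ℂ)
    refine (congrArg (fun z : ℂ => (s : ℂ) ^ k * z) (LightRay.contract_symMul _ _ _)).trans ?_
    rw [LightRay.contract_minkowski_lightDir hc ω, mul_zero, mul_zero]
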